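/- Let $m$ be the number of alternatives $a_1,\dots,a_m$. The Plackett–Luce model with parameter $\vec\theta\in\Theta=\{\vec\theta\in\mathbb R^m:\theta_m=0\}$ generates the ranking $R=a_{i_1}\succ a_{i_2}\succ\dots\succ a_{i_m}$ with probability $$\Pr(R\mid\vec\theta)=\prod_{t=1}^{m-1}\frac{e^{\theta_{i_t}}}{\sum_{l=t}^{m}e^{\theta_{i_l}}},$$ and $p_{ii'}(\vec\theta)$ denotes the total probability of the rankings in which $a_i$ is above $a_{i'}$. A weighted breaking $\mathcal G$ is a weighted undirected graph without loops on the positions $1,\dots,m$, with edge weights $g_{ll'}=g_{l'l}\ge 0$; it is nonempty if some weight is positive. For a profile $P=(R_1,\dots,R_n)$ of rankings and $i\neq i'$, let $\kappa_{ii'}=\frac1n\sum_{j=1}^n\mathcal G_{a_i\succ a_{i'}}(R_j)$, where $\mathcal G_{a_i\succ a_{i'}}(R)=g_{ll'}$ if $a_i$ is above $a_{i'}$ in $R$ and they are in positions $l<l'$, and $\mathcal G_{a_i\succ a_{i'}}(R)=0$ if $a_i$ is below $a_{i'}$. Given CML-weights $\mathcal W=(w_{ii'})_{i\neq i'}$,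 $\mathrm{RBCML}(\mathcal G,\mathcal W)$ estimates the parameter by a maximizer over $\Theta$ of the composite log-marginal likelihood $$\mathrm{CLL}(\vec\theta,P)=\sum_{i\neq i'}\kappa_{ii'}\,w_{ii'}\ln p_{ii'}(\vec\theta).$$ It is consistent for Plackett–Luce if, for every ground truth $\vec\theta_0\in\Theta$, when $P$ consists of $n$ independent rankings drawn from the model with parameter $\vec\theta_0$, the estimate converges to $\vec\theta_0$ in probability as $n\to\infty$, whichever maximizer is chosen if there are several, and whichever element of $\Theta$ is output if there is none. For $1\le k\le m-1$, the position-$k$ breaking has an edge of weight $1$ between $k$ and each $l>k$, and no other edges. **Theorem.** Let $\mathcal G$ be a nonempty weighted breaking and let $\mathcal W_{\mathrm u}$ be uniform, that is, all its weights are equal to one constant $w>0$. Then $\mathrm{RBCML}(\mathcal G,\mathcal W_{\mathrm u})$ is consistent for Plackett–Luce if and only if $\mathcal G$ is a weighted union of position-$k$ breakings, that is, there are $c_1,\dots,c_{m-1}\ge 0$ with $g_{kl}=c_k$ for all $1\le k<l\le m$. -/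

import Mathlib

open Filter Topology

noncomputable section

namespace RBCML

/-- A ranking (linear order) of the alternatives `Fin m`: `R t` is the alternative in position `t`
(position `0` is the top), and `R.symm a` is the position of the alternative `a`. -/
abbrev Ranking (m : ℕ) : Type := Equiv.Perm (Fin m)

/-- A preference profile of `n` rankings. -/
abbrev Profile (m n : ℕ) : Type := Fin n → Ranking m

/-- The parameter space: real vectors indexed by the alternatives, whose last coordinate is
normalized to `0`. -/
def paramSpace (m : ℕ) : Set (Fin m → ℝ) :=
  {θ | ∀ i : Fin m, (i : ℕ) + 1 = m → θ i = 0}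

/-- The probability of the ranking `R` under the Plackett-Luce model with parameter `θ`
(the factor of the last position is equal to `1`). -/
def plProb {m : ℕ} (θ : Fin m → ℝ) (R : Ranking m) : ℝ :=
  ∏ t : Fin m, Real.exp (θ (R t)) / ∑ l ∈ Finset.Ici t, Real.exp (θ (R l))

/-- The probability that `a` is ranked above `b` under the Plackett-Luce model with parameter `θ`:
the total probability of the rankings in which `a` is above `b`. -/
def pairProb {m : ℕ} (θ : Fin m → ℝ) (a b : Fin m) : ℝ :=
  ∑ R : Ranking m, if R.symm a < R.symm b then plProb θ R else 0

/-- The probability of the event `A` for a profile of `n` independent rankings, each drawn from the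
Plackett-Luce model with parameter `θ`. -/
def profileProb {m : ℕ} (θ : Fin m → ℝ) (n : ℕ) (A : Set (Profile m n)) : ℝ :=
  ∑ P : Profile m n, A.indicator (fun P => ∏ j, plProb θ (P j)) P

/-- A weighted rank-breaking: a weighted undirected graph without loops on the positions, with
nonnegative weights (weight zero means that there is no edge). -/
structure Breaking (m : ℕ) where
  weight : Fin m → Fin m → ℝ
  nonneg : ∀ i j, 0 ≤ weight i j
  symm : ∀ i j, weight i j = weight j i
  loopless : ∀ i, weight i i = 0

/-- The position-`k` breaking: unit-weight edges between `k` and all positions after `k`. -/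
def positionBreaking {m : ℕ} (k : Fin m) : Breaking m where
  weight i j := if (i = k ∧ k < j) ∨ (j = k ∧ k < i) then 1 else 0
  nonneg i j := by split_ifs <;> norm_num
  symm i j := by simp only [or_comm]
  loopless i := by
    rw [if_neg]
    rintro (⟨rfl, h⟩ | ⟨rfl, h⟩) <;> exact lt_irrefl _ h

/-- `G` is a weighted union of position-`k` breakings, with nonnegative weights `c k`
(the breaking of the last position has no edges, so that its weight plays no role). -/
def Breaking.IsWeightedUnion {m : ℕ} (G : Breaking m) : Prop :=
  ∃ c : Fin m → ℝ, (∀ k, 0 ≤ c k) ∧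
    ∀ i j, G.weight i j = ∑ k, c k * (positionBreaking k).weight i j

/-- The weight of the comparison `a ≻ b` that the breaking extracts from `R`: the weight of the edge
between the positions of `a` and `b` if `a` is ranked above `b`, and zero otherwise. -/
def Breaking.comparison {m : ℕ} (G : Breaking m) (a b : Fin m) (R : Ranking m) : ℝ :=
  if R.symm a < R.symm b then G.weight (R.symm a) (R.symm b) else 0

/-- `κ_{ab}`: the average weight of the comparison `a ≻ b` over the profile. -/
def Breaking.kappa {m n : ℕ} (G : Breaking m) (P : Profile m n) (a b : Fin m) : ℝ :=
  (∑ j, G.comparison a b (P j)) / n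

/-- The composite log-marginal likelihood, for the breaking `G` and the CML-weights `W`. -/
def cll {m n : ℕ} (G : Breaking m) (W : Fin m → Fin m → ℝ) (P : Profile m n)
    (θ : Fin m → ℝ) : ℝ :=
  ∑ a, ∑ b, if a ≠ b then G.kappa P a b * W a b * Real.log (pairProb θ a b) else 0

/-- The set of maximizers of the composite log-marginal likelihood over the parameter space. -/
def rbcml {m n : ℕ} (G : Breaking m) (W : Fin m → Fin m → ℝ) (P : Profile m n) :
    Set (Fin m → ℝ) :=
  {θ | θ ∈ paramSpace m ∧ IsMaxOn (cll G W P) (paramSpace m) θ}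

/-- An estimator: a parameter for each profile, for every number of rankings. -/
abbrev Estimator (m : ℕ) : Type := (n : ℕ) → Profile m n → (Fin m → ℝ)

/-- `T` is consistent for the Plackett-Luce model: for every ground truth `θ₀`, the estimate
from `n` independent rankings converges to `θ₀` in probability as `n → ∞`. -/
def Estimator.IsConsistentPL {m : ℕ} (T : Estimator m) : Prop :=
  ∀ θ₀ ∈ paramSpace m, ∀ ε > 0,
    Tendsto (fun n => profileProb θ₀ n {P | ε ≤ dist (T n P) θ₀}) atTop (𝓝 0)

/-- `T` takes its values in the parameter space and outputs a maximizer of the composite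
log-marginal likelihood on every profile for which there is one. -/
def Estimator.IsRBCML {m : ℕ} (T : Estimator m) (G : Breaking m) (W : Fin m → Fin m → ℝ) : Prop :=
  ∀ n (P : Profile m n), T n P ∈ paramSpace m ∧
    ((rbcml G W P).Nonempty → T n P ∈ rbcml G W P)

/-- RBCML with breaking `G` and CML-weights `W` is consistent for the Plackett-Luce model: whatever
maximizer is chosen where there are several, and whatever parameter is output where there is none,
the estimator is consistent. -/
def IsConsistentRBCML {m : ℕ} (G : Breaking m) (W : Fin m → Fin m → ℝ) : Prop :=
  ∀ T : Estimator m, T.IsRBCML G W → T.IsConsistentPL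

/-- The uniform CML-weight vector, all of whose weights are `w`. -/
def uniformWeights (m : ℕ) (w : ℝ) : Fin m → Fin m → ℝ := fun _ _ => w

end RBCML

end

/-! Write `x = exp θ`. If edge weights depend only on the upper position, the expected weights of `a
≻ b` and `b ≻ a` are in the ratio `x a : x b` (`kbar_balance`): among the alternatives still
unplaced, each is picked next with probability proportional to its weight. Unit edge weights give
the pairwise marginals `x a / (x a + x b)`.

Sufficiency: balance and Gibbs' inequality make the ground truth the unique maximizer of the
expected likelihood (`clik_lt_of_balanced`). The empirical `κ` converges in probability by
Chebyshev, and coercivity with compactness carries the maximizers along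
(`eventually_maximizers_near`).

Necessity: consistency forces the ground truth to maximize the expected likelihood, so the score
vanishes at every positive `x`. Letting one weight tend to infinity pins that alternative to the top
and leaves the same problem on the lower positions, so by induction only the top edges remain
unknown. The weights `(s, 1, ..., 1)` then say that the mean top-edge weight at the position of one
alternative does not depend on its weight `s`, and only constant functions of the position have this
property (`weight_eq_of_score_eq_zero`). -/

namespace RBCML

/-! ### Plackett-Luce probabilities in terms of positive weights -/

/-- The Plackett-Luce probability of a ranking, for the alternatives' weights `x = exp θ`. -/
noncomputable def plw {m : ℕ} (x : Fin m → ℝ) (R : Ranking m) : ℝ :=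
  ∏ t : Fin m, x (R t) / ∑ l ∈ Finset.Ici t, x (R l)

lemma plProb_eq_plw {m : ℕ} (θ : Fin m → ℝ) (R : Ranking m) :
    plProb θ R = plw (fun i => Real.exp (θ i)) R := rfl

/-- The weights of the alternatives that remain once `p` has been placed on top, numbered as in
`Equiv.Perm.decomposeFin`. -/
def remaining {m : ℕ} (x : Fin (m + 1) → ℝ) (p : Fin (m + 1)) : Fin m → ℝ :=
  fun i => x (Equiv.swap 0 p i.succ)

/-- The ranking with `p` on top, followed by `e`. -/
def consRanking {m : ℕ} (p : Fin (m + 1)) (e : Ranking m) : Ranking (m + 1) :=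
  Equiv.Perm.decomposeFin.symm (p, e)

lemma consRanking_zero {m : ℕ} (p : Fin (m + 1)) (e : Ranking m) : consRanking p e 0 = p :=
  Equiv.Perm.decomposeFin_symm_apply_zero p e

lemma consRanking_succ {m : ℕ} (p : Fin (m + 1)) (e : Ranking m) (i : Fin m) :
    consRanking p e i.succ = Equiv.swap 0 p (e i).succ :=
  Equiv.Perm.decomposeFin_symm_apply_succ e p i

lemma consRanking_symm_top {m : ℕ} (p : Fin (m + 1)) (e : Ranking m) :
    (consRanking p e).symm p = 0 := by
  rw [Equiv.symm_apply_eq, consRanking_zero]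

lemma consRanking_symm_swap {m : ℕ} (p : Fin (m + 1)) (e : Ranking m) (a : Fin m) :
    (consRanking p e).symm (Equiv.swap 0 p a.succ) = (e.symm a).succ := by
  rw [Equiv.symm_apply_eq, consRanking_succ, Equiv.apply_symm_apply]

lemma consRanking_zero_symm_succ {m : ℕ} (e : Ranking m) (a : Fin m) :
    (consRanking 0 e).symm a.succ = (e.symm a).succ := by
  simpa using consRanking_symm_swap 0 e a

lemma exists_eq_swap_succ {m : ℕ} {p a : Fin (m + 1)} (h : a ≠ p) :
    ∃ a' : Fin m, a = Equiv.swap 0 p a'.succ := by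
  have h0 : Equiv.swap 0 p a ≠ 0 := by
    intro h'
    rw [Equiv.swap_apply_eq_iff, Equiv.swap_apply_left] at h'
    exact h h'
  obtain ⟨a', ha'⟩ := Fin.exists_succ_eq.2 h0
  exact ⟨a', by rw [ha', Equiv.swap_apply_self]⟩

lemma remaining_pos {m : ℕ} {x : Fin (m + 1) → ℝ} (hx : ∀ i, 0 < x i) (p : Fin (m + 1))
    (i : Fin m) : 0 < remaining x p i := hx _

lemma plw_consRanking {m : ℕ} (x : Fin (m + 1) → ℝ) (p : Fin (m + 1)) (e : Ranking m) :
    plw x (consRanking p e) = x p / (∑ i, x i) * plw (remaining x p) e := by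
  unfold plw
  rw [Fin.prod_univ_succ]
  congr 1
  · rw [consRanking_zero, show (Finset.Ici (0 : Fin (m + 1))) = Finset.univ by ext; simp,
      Equiv.sum_comp (consRanking p e) x]
  · refine Finset.prod_congr rfl fun t _ => ?_
    rw [← Fin.map_succEmb_Ici, Finset.sum_map]
    simp only [Fin.coe_succEmb, consRanking_succ]
    rfl

/-- Conditioning on the top alternative. -/
lemma sum_plw_succ {m : ℕ} (x : Fin (m + 1) → ℝ) (f : Ranking (m + 1) → ℝ) :
    ∑ R, plw x R * f R =
      ∑ p, x p / (∑ i, x i) * ∑ e, plw (remaining x p) e * f (consRanking p e) := by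
  rw [← Equiv.sum_comp (Equiv.Perm.decomposeFin (n := m)).symm, Fintype.sum_prod_type]
  refine Finset.sum_congr rfl fun p _ => ?_
  rw [Finset.mul_sum]
  refine Finset.sum_congr rfl fun e _ => ?_
  change plw x (consRanking p e) * f (consRanking p e) = _
  rw [plw_consRanking, mul_assoc]

lemma plw_pos {m : ℕ} {x : Fin m → ℝ} (hx : ∀ i, 0 < x i) (R : Ranking m) : 0 < plw x R :=
  Finset.prod_pos fun _ _ =>
    div_pos (hx _) (Finset.sum_pos (fun _ _ => hx _) ⟨_, Finset.mem_Ici.2 le_rfl⟩)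

lemma sum_plw {m : ℕ} {x : Fin m → ℝ} (hx : ∀ i, 0 < x i) : ∑ R, plw x R = 1 := by
  induction m with
  | zero => simp [plw]
  | succ m ih =>
    have h := sum_plw_succ x (fun _ => 1)
    simp only [mul_one] at h
    have hs : 0 < ∑ i, x i := Finset.sum_pos (fun i _ => hx i) Finset.univ_nonempty
    rw [h, Finset.sum_congr rfl fun p _ => by rw [ih (remaining_pos hx p), mul_one],
      ← Finset.sum_div, div_self hs.ne']

lemma plw_le_one {m : ℕ} {x : Fin m → ℝ} (hx : ∀ i, 0 < x i) (R : Ranking m) : plw x R ≤ 1 := by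
  rw [← sum_plw hx]
  exact Finset.single_le_sum (fun R _ => (plw_pos hx R).le) (Finset.mem_univ R)

/-- Scale invariance is what makes the normalization of the last parameter harmless. -/
lemma plw_smul {m : ℕ} (x : Fin m → ℝ) {c : ℝ} (hc : c ≠ 0) (R : Ranking m) :
    plw (fun i => c * x i) R = plw x R := by
  unfold plw
  refine Finset.prod_congr rfl fun t _ => ?_
  rw [← Finset.mul_sum, mul_div_mul_left _ _ hc]

/-! ### Expected comparison weights -/

/-- The weight of the comparison `a ≻ b` extracted from `R`, for real edge weights `g`. -/
def comp {m : ℕ} (g : Fin m → Fin m → ℝ) (a b : Fin m) (R : Ranking m) : ℝ :=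
  if R.symm a < R.symm b then g (R.symm a) (R.symm b) else 0

/-- The expected weight of the comparison `a ≻ b`. -/
noncomputable def kbar {m : ℕ} (g : Fin m → Fin m → ℝ) (x : Fin m → ℝ) (a b : Fin m) : ℝ :=
  ∑ R, plw x R * comp g a b R

lemma comp_self {m : ℕ} (g : Fin m → Fin m → ℝ) (a : Fin m) (R : Ranking m) :
    comp g a a R = 0 := by simp [comp]

lemma kbar_self {m : ℕ} (g : Fin m → Fin m → ℝ) (x : Fin m → ℝ) (a : Fin m) :
    kbar g x a a = 0 := by simp [kbar, comp_self]

lemma kbar_sub {m : ℕ} (g g' : Fin m → Fin m → ℝ) (x : Fin m → ℝ) (a b : Fin m) :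
    kbar (fun i j => g i j - g' i j) x a b = kbar g x a b - kbar g' x a b := by
  unfold kbar comp
  rw [← Finset.sum_sub_distrib]
  refine Finset.sum_congr rfl fun R _ => ?_
  split_ifs <;> ring

/-- If the edge weights only depend on the upper position, the expected weights of `a ≻ b` and
`b ≻ a` are in the ratio of the weights of `a` and `b`. -/
lemma kbar_balance {m : ℕ} (c : Fin m → ℝ) {x : Fin m → ℝ} (hx : ∀ i, 0 < x i) (a b : Fin m) :
    kbar (fun k _ => c k) x a b * x b = kbar (fun k _ => c k) x b a * x a := by
  induction m with
  | zero => exact a.elim0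
  | succ m ih =>
    rcases eq_or_ne a b with rfl | hab
    · rfl
    have key : ∀ a b : Fin (m + 1), a ≠ b → ∀ p, p ≠ a → p ≠ b → ∃ a' b' : Fin m,
        a = Equiv.swap 0 p a'.succ ∧ b = Equiv.swap 0 p b'.succ := by
      intro a b _ p ha hb
      obtain ⟨a', ha'⟩ := exists_eq_swap_succ ha.symm
      obtain ⟨b', hb'⟩ := exists_eq_swap_succ hb.symm
      exact ⟨a', b', ha', hb'⟩
    have htop : ∀ a b : Fin (m + 1), a ≠ b →
        ∑ e, plw (remaining x a) e * comp (fun k _ => c k) a b (consRanking a e) = c 0 := by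
      intro a b hab
      obtain ⟨b', hb'⟩ := exists_eq_swap_succ hab.symm
      have : ∀ e : Ranking m, comp (fun k _ => c k) a b (consRanking a e) = c 0 := by
        intro e
        have h1 := consRanking_symm_swap a e b'
        rw [← hb'] at h1
        simp [comp, consRanking_symm_top, h1]
      simp only [this]
      rw [← Finset.sum_mul, sum_plw (remaining_pos hx a), one_mul]
    have hbot : ∀ a b : Fin (m + 1),
        ∑ e, plw (remaining x b) e * comp (fun k _ => c k) a b (consRanking b e) = 0 := by
      intro a b
      simp [comp, consRanking_symm_top]
    unfold kbar
    -- Condition on the top alternative and match `a` on top on one side with `b` on top on the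
    -- other: both give `c 0 * x a * x b` over the total weight. Any other top alternative is
    -- covered by induction.
    rw [sum_plw_succ, sum_plw_succ, Finset.sum_mul, Finset.sum_mul,
      ← Equiv.sum_comp (Equiv.swap a b)]
    refine Finset.sum_congr rfl fun p _ => ?_
    rcases eq_or_ne p a with rfl | hpa
    · rw [Equiv.swap_apply_left, hbot, hbot]
      simp
    rcases eq_or_ne p b with rfl | hpb
    · rw [Equiv.swap_apply_right, htop _ _ hab, htop _ _ hab.symm]
      ring
    rw [Equiv.swap_apply_of_ne_of_ne hpa hpb]
    obtain ⟨a', b', ha', hb'⟩ := key a b hab p hpa hpb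
    have h := ih (fun k => c k.succ) (remaining_pos hx p) a' b'
    have hc : ∀ (a' b' : Fin m) (e : Ranking m),
        comp (fun k _ => c k) (Equiv.swap 0 p a'.succ) (Equiv.swap 0 p b'.succ) (consRanking p e)
          = comp (fun k _ => c k.succ) a' b' e := by
      intro a' b' e
      simp [comp, consRanking_symm_swap]
    simp only [kbar, remaining, ← ha', ← hb'] at h
    have h1 := fun e => hc a' b' e
    have h2 := fun e => hc b' a' e
    rw [← ha', ← hb'] at h1 h2
    simp only [h1, h2]
    rw [mul_assoc, mul_assoc]
    exact congrArg _ h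

lemma kbar_add_swap_one {m : ℕ} {x : Fin m → ℝ} (hx : ∀ i, 0 < x i) {a b : Fin m} (hab : a ≠ b) :
    kbar (fun _ _ => 1) x a b + kbar (fun _ _ => 1) x b a = 1 := by
  unfold kbar
  rw [← Finset.sum_add_distrib]
  refine Eq.trans ?_ (sum_plw hx)
  refine Finset.sum_congr rfl fun R _ => ?_
  have : R.symm a ≠ R.symm b := fun h => hab (R.symm.injective h)
  rcases lt_or_gt_of_ne this with h | h <;> simp [comp, h, h.not_gt]

/-- The pairwise marginals of the Plackett-Luce model. -/
lemma pairProb_eq {m : ℕ} (θ : Fin m → ℝ) {a b : Fin m} (hab : a ≠ b) :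
    pairProb θ a b = Real.exp (θ a) / (Real.exp (θ a) + Real.exp (θ b)) := by
  have hx : ∀ i, 0 < Real.exp (θ i) := fun i => Real.exp_pos _
  have h1 := kbar_add_swap_one hx hab
  have h2 := kbar_balance (fun _ => 1) hx a b
  have h3 : pairProb θ a b = kbar (fun _ _ => 1) (fun i => Real.exp (θ i)) a b := by
    unfold pairProb kbar comp
    refine Finset.sum_congr rfl fun R _ => ?_
    rw [mul_ite, mul_one, mul_zero, plProb_eq_plw]
  have := hx a
  have := hx b
  rw [h3, eq_div_iff (by positivity), mul_add, h2, ← add_mul, h1, one_mul]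

lemma log_pairProb {m : ℕ} (θ : Fin m → ℝ) {a b : Fin m} (hab : a ≠ b) :
    Real.log (pairProb θ a b) = θ a - Real.log (Real.exp (θ a) + Real.exp (θ b)) := by
  rw [pairProb_eq θ hab, Real.log_div (Real.exp_pos _).ne' (by positivity), Real.log_exp]

/-- With edge weights `g ≥ 0`, not all zero above the diagonal, all comparisons have positive
expected weight. -/
lemma kbar_pos {m : ℕ} {g : Fin m → Fin m → ℝ} (hg : ∀ i j, 0 ≤ g i j) {i j : Fin m}
    (hij : i < j) (hgij : 0 < g i j) {x : Fin m → ℝ} (hx : ∀ i, 0 < x i) {a b : Fin m}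
    (hab : a ≠ b) : 0 < kbar g x a b := by
  have hnn : ∀ R, 0 ≤ plw x R * comp g a b R := by
    intro R
    refine mul_nonneg (plw_pos hx R).le ?_
    unfold comp
    split_ifs
    exacts [hg _ _, le_rfl]
  -- Every ranking has positive probability, so one with `a`, `b` in positions `i`, `j` suffices.
  -- The outer swap corrects the image of `j` without moving `a`.
  obtain ⟨R, hRi, hRj⟩ : ∃ R : Ranking m, R i = a ∧ R j = b := by
    refine ⟨Equiv.swap (Equiv.swap i a j) b * Equiv.swap i a, ?_, ?_⟩
    · rw [Equiv.Perm.mul_apply, Equiv.swap_apply_left, Equiv.swap_apply_of_ne_of_ne _ hab]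
      intro h
      have := (Equiv.swap i a).injective ((Equiv.swap_apply_left i a).trans h)
      exact hij.ne this
    · rw [Equiv.Perm.mul_apply, Equiv.swap_apply_left]
  refine Finset.sum_pos' (fun R _ => hnn R) ⟨R, Finset.mem_univ R, ?_⟩
  refine mul_pos (plw_pos hx R) ?_
  rw [← hRi, ← hRj]
  simpa [comp, hij] using hgij

/-! ### The score equations determine the breaking -/

/-- The derivative of the expected composite log-likelihood, at the ground truth and with respect to
the parameter of `a`, for uniform weights equal to `1`. -/
noncomputable def score {m : ℕ} (g : Fin m → Fin m → ℝ) (x : Fin m → ℝ) (a : Fin m) : ℝ :=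
  ∑ b, (kbar g x a b * x b - kbar g x b a * x a) / (x a + x b)

lemma score_sub {m : ℕ} (g g' : Fin m → Fin m → ℝ) (x : Fin m → ℝ) (a : Fin m) :
    score (fun i j => g i j - g' i j) x a = score g x a - score g' x a := by
  unfold score
  rw [← Finset.sum_sub_distrib]
  refine Finset.sum_congr rfl fun b _ => ?_
  rw [kbar_sub, kbar_sub]
  ring

lemma score_smul {m : ℕ} (g : Fin m → Fin m → ℝ) (x : Fin m → ℝ) {c : ℝ} (hc : c ≠ 0)
    (a : Fin m) : score g (fun i => c * x i) a = score g x a := by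
  unfold score kbar
  simp only [plw_smul x hc]
  refine Finset.sum_congr rfl fun b _ => ?_
  rw [← mul_add, ← mul_div_mul_left _ (x a + x b) hc]
  ring

/-- Comparisons read only the entries above the diagonal, so symmetric weights may be traded for
`fun k _ => c k`. -/
lemma kbar_congr {m : ℕ} {g g' : Fin m → Fin m → ℝ} (h : ∀ i j, i < j → g i j = g' i j)
    (x : Fin m → ℝ) (a b : Fin m) : kbar g x a b = kbar g' x a b := by
  unfold kbar comp
  refine Finset.sum_congr rfl fun R _ => ?_
  split_ifs with hR
  · rw [h _ _ hR]
  · rfl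

lemma score_of_balanced {m : ℕ} (c : Fin m → ℝ) {x : Fin m → ℝ} (hx : ∀ i, 0 < x i) (a : Fin m) :
    score (fun k _ => c k) x a = 0 := by
  unfold score
  refine Finset.sum_eq_zero fun b _ => ?_
  rw [kbar_balance c hx a b, sub_self, zero_div]

lemma cons_pos {m : ℕ} {y : Fin m → ℝ} (hy : ∀ i, 0 < y i) {M : ℝ} (hM : 0 < M)
    (i : Fin (m + 1)) : 0 < (Fin.cons M y : Fin (m + 1) → ℝ) i := by
  refine Fin.cases ?_ (fun j => ?_) i
  · simpa using hM
  · simpa using hy j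

/-- As the weight of the alternative `0` tends to infinity, it takes the top position. -/
lemma tendsto_sum_plw_cons {m : ℕ} {y : Fin m → ℝ} (hy : ∀ i, 0 < y i)
    (f : Ranking (m + 1) → ℝ) :
    Tendsto (fun M : ℝ => ∑ R, plw (Fin.cons M y : Fin (m + 1) → ℝ) R * f R) atTop
      (𝓝 (∑ e, plw y e * f (consRanking 0 e))) := by
  have hrem : ∀ M : ℝ, remaining (Fin.cons M y : Fin (m + 1) → ℝ) 0 = y := by
    intro M
    funext i
    simp [remaining]
  have hden : ∀ C : ℝ, Tendsto (fun M : ℝ => C / (M + ∑ i, y i)) atTop (𝓝 0) := fun C =>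
    tendsto_const_nhds.div_atTop (tendsto_atTop_add_const_right _ _ tendsto_id)
  have hY : 0 ≤ ∑ i, y i := Finset.sum_nonneg fun i _ => (hy i).le
  simp only [sum_plw_succ, Fin.sum_univ_succ, Fin.cons_zero, Fin.cons_succ, hrem]
  rw [← add_zero (∑ e, plw y e * f (consRanking 0 e))]
  refine Tendsto.add ?_ ?_
  · have h1 : Tendsto (fun M : ℝ => M / (M + ∑ i, y i)) atTop (𝓝 1) := by
      have h2 := (tendsto_const_nhds (x := (1 : ℝ)) (f := atTop)).sub (hden (∑ i, y i))
      rw [sub_zero] at h2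
      refine h2.congr' ?_
      filter_upwards [eventually_gt_atTop 0] with M hM
      have : M + ∑ i, y i ≠ 0 := by positivity
      field_simp
      ring
    simpa using h1.mul_const (∑ e, plw y e * f (consRanking 0 e))
  · rw [← Finset.sum_const_zero (ι := Fin m) (s := Finset.univ)]
    refine tendsto_finsetSum _ fun q _ => ?_
    -- The conditional probabilities still involve `M`, but they are at most `1`, which bounds the
    -- inner sum uniformly in `M`.
    refine squeeze_zero_norm' ?_ (hden (y q * ∑ e, |f (consRanking q.succ e)|))
    filter_upwards [eventually_gt_atTop 0] with M hM
    have hpos : 0 ≤ y q / (M + ∑ i, y i) := div_nonneg (hy q).le (by positivity)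
    rw [Real.norm_eq_abs, abs_mul, abs_of_nonneg hpos, mul_div_right_comm]
    refine mul_le_mul_of_nonneg_left ?_ hpos
    refine (Finset.abs_sum_le_sum_abs _ _).trans (Finset.sum_le_sum fun e _ => ?_)
    have hr := remaining_pos (cons_pos hy hM) q.succ
    rw [abs_mul, abs_of_pos (plw_pos hr e)]
    exact mul_le_of_le_one_left (abs_nonneg _) (plw_le_one hr e)

lemma tendsto_kbar_cons {m : ℕ} (g : Fin (m + 1) → Fin (m + 1) → ℝ) {y : Fin m → ℝ}
    (hy : ∀ i, 0 < y i) (a b : Fin m) :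
    Tendsto (fun M : ℝ => kbar g (Fin.cons M y : Fin (m + 1) → ℝ) a.succ b.succ) atTop
      (𝓝 (kbar (fun i j => g i.succ j.succ) y a b)) := by
  have h := tendsto_sum_plw_cons hy (comp g a.succ b.succ)
  simpa [kbar, comp, consRanking_zero_symm_succ] using h

/-- The pair with `0` drops out: beating `0` becomes improbable, and losing to `0` carries the
factor `y a / (y a + M)`. -/
lemma tendsto_score_cons {m : ℕ} (g : Fin (m + 1) → Fin (m + 1) → ℝ) {y : Fin m → ℝ}
    (hy : ∀ i, 0 < y i) (a : Fin m) :
    Tendsto (fun M : ℝ => score g (Fin.cons M y : Fin (m + 1) → ℝ) a.succ) atTop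
      (𝓝 (score (fun i j => g i.succ j.succ) y a)) := by
  unfold score
  simp only [Fin.sum_univ_succ, Fin.cons_zero, Fin.cons_succ]
  rw [← zero_add (∑ b, (kbar (fun i j => g i.succ j.succ) y a b * y b
    - kbar (fun i j => g i.succ j.succ) y b a * y a) / (y a + y b))]
  refine Tendsto.add ?_ (tendsto_finsetSum _ fun b _ => ?_)
  · have hinf : Tendsto (fun M : ℝ => y a + M) atTop atTop :=
      tendsto_atTop_add_const_left _ _ tendsto_id
    have h1 := tendsto_sum_plw_cons hy (comp g a.succ 0)
    have h2 := tendsto_sum_plw_cons hy (comp g 0 a.succ)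
    have h3 : ∑ e, plw y e * comp g a.succ 0 (consRanking 0 e) = 0 := by
      simp [comp, consRanking_symm_top]
    rw [h3] at h1
    have h4 := ((h1.mul (tendsto_const_nhds (x := (1 : ℝ)) |>.sub
      ((tendsto_const_nhds (x := y a)).div_atTop hinf))).sub
      ((h2.mul_const (y a)).div_atTop hinf))
    simp only [zero_mul, sub_zero] at h4
    refine h4.congr' ?_
    filter_upwards [eventually_gt_atTop 0] with M hM
    have : y a + M ≠ 0 := (add_pos (hy a) hM).ne'
    simp only [kbar]
    field_simp
    ring
  · exact (((tendsto_kbar_cons g hy a b).mul_const _).sub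
      ((tendsto_kbar_cons g hy b a).mul_const _)).div_const _

/-- The expectation of `h` at the position of an alternative of weight `s`, when the `n - 1` other
alternatives have weight `1`. -/
noncomputable def posMean : (n : ℕ) → (Fin n → ℝ) → ℝ → ℝ
  | 0, _, _ => 0
  | n + 1, h, s => (s * h 0 + n * posMean n (fun i => h i.succ) s) / (n + s)

lemma posMean_zero (n : ℕ) (s : ℝ) : posMean n (fun _ => 0) s = 0 := by
  induction n with
  | zero => rfl
  | succ n ih => simp [posMean, ih]

lemma update_one_pos {n : ℕ} (a : Fin n) {s : ℝ} (hs : 0 < s) (i : Fin n) :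
    0 < Function.update (fun _ => (1 : ℝ)) a s i := by
  rcases eq_or_ne i a with rfl | h
  · simpa using hs
  · simp [h]

/-- The special alternative is on top with probability `s / (n + s)`; otherwise one of `n`
interchangeable unit alternatives is, and the positions shift by one. -/
lemma sum_plw_update (n : ℕ) (h : Fin n → ℝ) (a : Fin n) {s : ℝ} (hs : 0 < s) :
    ∑ R, plw (Function.update (fun _ => (1 : ℝ)) a s) R * h (R.symm a) = posMean n h s := by
  induction n with
  | zero => exact a.elim0
  | succ n ih =>
    set x := Function.update (fun _ => (1 : ℝ)) a s with hxdef
    have hx : ∀ i, 0 < x i := update_one_pos a hs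
    have hsum : ∑ i, x i = n + s := by
      rw [← Finset.add_sum_erase _ _ (Finset.mem_univ a),
        Finset.sum_congr rfl fun i hi => Function.update_of_ne (Finset.ne_of_mem_erase hi) _ _]
      simp [hxdef, add_comm]
    have hother : ∀ p ∈ Finset.univ.erase a,
        x p / (∑ i, x i) * ∑ e, plw (remaining x p) e * h ((consRanking p e).symm a)
          = 1 / (n + s) * posMean n (fun i => h i.succ) s := by
      intro p hp
      have hpa := Finset.ne_of_mem_erase hp
      obtain ⟨a', ha'⟩ := exists_eq_swap_succ hpa.symm
      have hrem : remaining x p = Function.update (fun _ => (1 : ℝ)) a' s := by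
        funext i
        rcases eq_or_ne i a' with rfl | hi
        · simp [remaining, ← ha', hxdef]
        · have : Equiv.swap 0 p i.succ ≠ a := by
            rw [ha']
            exact fun h => hi (Fin.succ_injective _ ((Equiv.swap 0 p).injective h))
          simp [remaining, hxdef, this, hi]
      have hsymm : ∀ e : Ranking n, (consRanking p e).symm a = (e.symm a').succ := by
        intro e
        rw [ha', consRanking_symm_swap]
      rw [hsum, hxdef, Function.update_of_ne hpa, ← hxdef, hrem]
      simp only [hsymm]
      rw [ih (fun i => h i.succ) a']
    rw [sum_plw_succ x fun R => h (R.symm a), ← Finset.add_sum_erase _ _ (Finset.mem_univ a),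
      Finset.sum_congr rfl hother]
    simp only [consRanking_symm_top]
    rw [← Finset.sum_mul, sum_plw (remaining_pos hx a), hsum]
    have : x a = s := by simp [hxdef]
    rw [this]
    have : (n : ℝ) + s ≠ 0 := by positivity
    simp [posMean]
    field_simp

/-- Each recursion step is a convex combination. Uniformity in `s` is the point. -/
lemma abs_posMean_le (n : ℕ) (h : Fin n → ℝ) {B : ℝ} (hB : 0 ≤ B) (hh : ∀ i, |h i| ≤ B) {s : ℝ}
    (hs : 0 < s) : |posMean n h s| ≤ B := by
  induction n with
  | zero => simpa [posMean] using hB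
  | succ n ih =>
    have h1 := ih (fun i => h i.succ) fun i => hh _
    have hp : 0 < (n : ℝ) + s := by positivity
    rw [posMean, abs_div, abs_of_pos hp, div_le_iff₀ hp]
    calc |s * h 0 + n * posMean n (fun i => h i.succ) s|
        ≤ s * |h 0| + n * |posMean n (fun i => h i.succ) s| := by
          refine (abs_add_le _ _).trans ?_
          rw [abs_mul, abs_mul, abs_of_pos hs, Nat.abs_cast]
      _ ≤ s * B + n * B := by gcongr; exact hh 0
      _ = B * (n + s) := by ring

/-- Only constant functions of the position have a mean that does not depend on the weight. -/
lemma eq_const_of_posMean_const (n : ℕ) (h : Fin n → ℝ) (C : ℝ)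
    (hC : ∀ s > 0, posMean n h s = C) (k : Fin n) : h k = C := by
  induction n with
  | zero => exact k.elim0
  | succ n ih =>
    set B := ∑ i, |h i| with hBdef
    have hB : ∀ i, |h i| ≤ B := fun i =>
      Finset.single_le_sum (fun i _ => abs_nonneg (h i)) (Finset.mem_univ i)
    have hB0 : 0 ≤ B := Finset.sum_nonneg fun i _ => abs_nonneg _
    -- The right side stays bounded as `s` grows, which forces `h 0 = C`; the tail mean is then also
    -- constantly `C`.
    have heq : ∀ s > 0, s * (C - h 0) = n * (posMean n (fun i => h i.succ) s - C) := by
      intro s hs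
      have h1 := hC s hs
      rw [posMean, div_eq_iff (by positivity)] at h1
      linarith
    have hbd : ∀ s > 0, s * |C - h 0| ≤ n * (B + |C|) := by
      intro s hs
      have h1 := congrArg abs (heq s hs)
      rw [abs_mul, abs_mul, abs_of_pos hs, Nat.abs_cast] at h1
      rw [h1]
      gcongr
      refine (abs_sub _ _).trans ?_
      gcongr
      exact abs_posMean_le n _ hB0 (fun i => hB _) hs
    have h0 : C - h 0 = 0 := by
      by_contra hne
      have hpos : 0 < |C - h 0| := abs_pos.2 hne
      have h1 := hbd ((n * (B + |C|) + 1) / |C - h 0|) (by positivity)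
      rw [div_mul_cancel₀ _ hpos.ne'] at h1
      linarith
    refine Fin.cases (by linarith) (fun j => ?_) k
    refine ih (fun i => h i.succ) (fun s hs => ?_) j
    have h1 := heq s hs
    rw [h0, mul_zero] at h1
    have hn : (n : ℝ) ≠ 0 := by
      have := j.pos
      positivity
    rcases mul_eq_zero.1 h1.symm with h2 | h2
    · exact absurd h2 hn
    · linarith

/-- All denominators equal `s + 1`, and summing over opponents is summing over positions: what
remains is the total edge weight below minus `s` times that above the position of `a`, in
expectation. -/
lemma score_update {n : ℕ} (g : Fin n → Fin n → ℝ) (a : Fin n) {s : ℝ} (hs : 0 < s) :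
    score g (Function.update (fun _ => (1 : ℝ)) a s) a * (s + 1) =
      posMean n (fun k => ∑ l, if k < l then g k l else 0) s
        - s * posMean n (fun k => ∑ l, if l < k then g l k else 0) s := by
  set x := Function.update (fun _ => (1 : ℝ)) a s with hxdef
  have hxa : x a = s := by simp [hxdef]
  have h1 : score g x a * (s + 1) = (∑ b, kbar g x a b) - s * ∑ b, kbar g x b a := by
    rw [score, Finset.sum_mul, Finset.mul_sum, ← Finset.sum_sub_distrib]
    refine Finset.sum_congr rfl fun b _ => ?_
    rcases eq_or_ne b a with rfl | hb
    · simp [kbar_self]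
    · have hxb : x b = 1 := by simp [hxdef, hb]
      rw [hxa, hxb]
      have : s + 1 ≠ 0 := by positivity
      field_simp
  rw [h1, ← sum_plw_update n _ a hs, ← sum_plw_update n _ a hs]
  unfold kbar comp
  rw [Finset.sum_comm, Finset.sum_comm (s := Finset.univ (α := Fin n))]
  congr 1
  · refine Finset.sum_congr rfl fun R _ => ?_
    rw [← Finset.mul_sum, Equiv.sum_comp R.symm fun l => if R.symm a < l then g (R.symm a) l else 0]
  · congr 1
    refine Finset.sum_congr rfl fun R _ => ?_
    rw [← Finset.mul_sum, Equiv.sum_comp R.symm fun l => if l < R.symm a then g l (R.symm a) else 0]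

/-- If the score vanishes identically, the weights only depend on the upper position. -/
theorem weight_eq_of_score_eq_zero {m : ℕ} (g : Fin m → Fin m → ℝ)
    (h : ∀ x : Fin m → ℝ, (∀ i, 0 < x i) → ∀ a, score g x a = 0) :
    ∃ c : Fin m → ℝ, ∀ k l, k < l → g k l = c k := by
  induction m with
  | zero => exact ⟨fun _ => 0, fun k => k.elim0⟩
  | succ m ih =>
    obtain ⟨c, hc⟩ := ih (fun i j => g i.succ j.succ) fun y hy a => by
      refine tendsto_nhds_unique (tendsto_score_cons g hy a) ?_
      refine tendsto_const_nhds.congr' ?_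
      filter_upwards [eventually_gt_atTop 0] with M hM
      exact (h _ (cons_pos hy hM) _).symm
    -- Subtracting this balanced part leaves the score unchanged and removes all edges except those
    -- at the top position.
    set c' : Fin (m + 1) → ℝ := Fin.cons 0 c with hc'
    set u : Fin m → ℝ := fun l => g 0 l.succ with hu
    set g' : Fin (m + 1) → Fin (m + 1) → ℝ := fun i j => g i j - c' i with hg'
    have hg's : ∀ (k : Fin m) (l : Fin (m + 1)), k.succ < l → g' k.succ l = 0 := by
      intro k l hkl
      obtain ⟨l', rfl⟩ := Fin.exists_succ_eq.2 (Fin.ne_zero_of_lt hkl)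
      have := hc k l' (Fin.succ_lt_succ_iff.1 hkl)
      simp [hg', hc', this]
    have hg'0 : ∀ l, g' 0 l = g 0 l := fun l => by simp [hg', hc']
    have hmean : ∀ s > 0, (m : ℝ) * posMean m u s = ∑ l, u l := by
      intro s hs
      have h1 : score g' (Function.update (fun _ => (1 : ℝ)) 0 s) 0 = 0 := by
        have hx := update_one_pos (0 : Fin (m + 1)) hs
        rw [hg', score_sub g (fun i _ => c' i), h _ hx, score_of_balanced c' hx, sub_zero]
      have h2 := score_update g' 0 hs
      rw [h1, zero_mul, posMean, posMean] at h2
      have hU : ∀ k : Fin m, (∑ l, if k.succ < l then g' k.succ l else 0) = 0 := by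
        intro k
        refine Finset.sum_eq_zero fun l _ => ?_
        split_ifs with hkl
        exacts [hg's k l hkl, rfl]
      have hU0 : (∑ l, if 0 < l then g' 0 l else 0) = ∑ l, u l := by
        rw [Fin.sum_univ_succ]
        simp [hg'0, hu]
      have hD : ∀ k : Fin m, (∑ l, if l < k.succ then g' l k.succ else 0) = u k := by
        intro k
        rw [Fin.sum_univ_succ]
        simp only [Fin.succ_pos, if_true, hg'0]
        rw [Finset.sum_eq_zero, add_zero]
        intro l _
        split_ifs with hkl
        exacts [hg's l _ hkl, rfl]
      have hD0 : (∑ l : Fin (m + 1), if l < 0 then g' l 0 else 0) = 0 := by simp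
      simp only [hU, hU0, hD, hD0, posMean_zero] at h2
      have : (m : ℝ) + s ≠ 0 := by positivity
      field_simp at h2
      refine mul_left_cancel₀ hs.ne' ?_
      linear_combination h2
    -- By `hmean`, the constant value of `u` can only be its average.
    refine ⟨Fin.cons ((∑ l, u l) / m) c, fun k l hkl => ?_⟩
    obtain ⟨l, rfl⟩ := Fin.exists_succ_eq.2 (Fin.ne_zero_of_lt hkl)
    revert hkl
    refine Fin.cases (fun _ => ?_) (fun k hkl => ?_) k
    · have hm : (m : ℝ) ≠ 0 := by
        have := l.pos
        positivity
      simp only [Fin.cons_zero]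
      refine eq_const_of_posMean_const m u _ (fun s hs => ?_) l
      rw [eq_div_iff hm, mul_comm, hmean s hs]
    · simpa using hc k l (Fin.succ_lt_succ_iff.1 hkl)

/-! ### The weak law of large numbers for profiles -/

section WeakLaw

variable {α : Type*} [Fintype α] (p : α → ℝ)

lemma sum_prod_cons (n : ℕ) (f : (Fin (n + 1) → α) → ℝ) :
    ∑ P, (∏ j, p (P j)) * f P =
      ∑ r, p r * ∑ Q : Fin n → α, (∏ j, p (Q j)) * f (Fin.cons r Q : Fin (n + 1) → α) := by
  rw [← Equiv.sum_comp (Fin.consEquiv fun _ => α), Fintype.sum_prod_type]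
  refine Finset.sum_congr rfl fun r _ => ?_
  rw [Finset.mul_sum]
  refine Finset.sum_congr rfl fun Q _ => ?_
  simp [Fin.consEquiv, Fin.prod_univ_succ, mul_assoc]

variable {p}

lemma sum_prod_eq_one (hp : ∑ r, p r = 1) (n : ℕ) :
    ∑ P : Fin n → α, ∏ j, p (P j) = 1 := by
  induction n with
  | zero => simp
  | succ n ih =>
    have h := sum_prod_cons p n fun _ => 1
    simp only [mul_one, ih, hp] at h
    exact h

lemma sum_prod_mul_sum (hp : ∑ r, p r = 1) {Y : α → ℝ} (hY : ∑ r, p r * Y r = 0) (n : ℕ) :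
    ∑ P : Fin n → α, (∏ j, p (P j)) * ∑ j, Y (P j) = 0 := by
  induction n with
  | zero => simp
  | succ n ih =>
    rw [sum_prod_cons]
    simp only [Fin.sum_univ_succ, Fin.cons_zero, Fin.cons_succ, mul_add, Finset.sum_add_distrib]
    simp only [ih, ← Finset.sum_mul, sum_prod_eq_one hp, one_mul, mul_zero,
      Finset.sum_const_zero, add_zero, hY]

/-- Splitting off one draw, the cross term vanishes by independence and centering. -/
lemma sum_prod_mul_sum_sq (hp : ∑ r, p r = 1) {Y : α → ℝ} (hY : ∑ r, p r * Y r = 0) (n : ℕ) :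
    ∑ P : Fin n → α, (∏ j, p (P j)) * (∑ j, Y (P j)) ^ 2 = n * ∑ r, p r * Y r ^ 2 := by
  induction n with
  | zero => simp
  | succ n ih =>
    rw [sum_prod_cons]
    have h : ∀ r, ∑ Q : Fin n → α, (∏ j, p (Q j)) *
        (∑ j, Y ((Fin.cons r Q : Fin (n + 1) → α) j)) ^ 2
          = Y r ^ 2 + n * ∑ r, p r * Y r ^ 2 := by
      intro r
      have h1 : ∀ Q : Fin n → α, (∏ j, p (Q j)) *
          (∑ j, Y ((Fin.cons r Q : Fin (n + 1) → α) j)) ^ 2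
            = (∏ j, p (Q j)) * Y r ^ 2 + 2 * Y r * ((∏ j, p (Q j)) * ∑ j, Y (Q j))
              + (∏ j, p (Q j)) * (∑ j, Y (Q j)) ^ 2 := by
        intro Q
        simp only [Fin.sum_univ_succ, Fin.cons_zero, Fin.cons_succ]
        ring
      simp only [h1, Finset.sum_add_distrib]
      rw [← Finset.sum_mul, ← Finset.mul_sum, sum_prod_eq_one hp, sum_prod_mul_sum hp hY, ih]
      ring
    simp only [h, mul_add, Finset.sum_add_distrib]
    rw [← Finset.sum_mul, hp]
    push_cast
    ring

end WeakLaw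

lemma sum_plProb {m : ℕ} (θ : Fin m → ℝ) : ∑ R, plProb θ R = 1 := by
  simpa only [plProb_eq_plw] using sum_plw fun i => Real.exp_pos (θ i)

lemma plProb_pos {m : ℕ} (θ : Fin m → ℝ) (R : Ranking m) : 0 < plProb θ R :=
  plw_pos (fun i => Real.exp_pos (θ i)) R

lemma prod_plProb_nonneg {m n : ℕ} (θ : Fin m → ℝ) (P : Profile m n) :
    0 ≤ ∏ j, plProb θ (P j) :=
  Finset.prod_nonneg fun _ _ => (plProb_pos θ _).le

lemma profileProb_nonneg {m : ℕ} (θ : Fin m → ℝ) (n : ℕ) (A : Set (Profile m n)) :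
    0 ≤ profileProb θ n A :=
  Finset.sum_nonneg fun P _ => Set.indicator_nonneg (fun P _ => prod_plProb_nonneg θ P) P

lemma profileProb_mono {m : ℕ} (θ : Fin m → ℝ) (n : ℕ) {A B : Set (Profile m n)} (h : A ⊆ B) :
    profileProb θ n A ≤ profileProb θ n B :=
  Finset.sum_le_sum fun P _ =>
    Set.indicator_le_indicator_of_subset h (fun P => prod_plProb_nonneg θ P) P

lemma profileProb_add_compl {m : ℕ} (θ : Fin m → ℝ) (n : ℕ) (A : Set (Profile m n)) :
    profileProb θ n A + profileProb θ n Aᶜ = 1 := by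
  unfold profileProb
  rw [← Finset.sum_add_distrib, ← sum_prod_eq_one (sum_plProb θ) n]
  refine Finset.sum_congr rfl fun P _ => ?_
  exact congrFun (Set.indicator_self_add_compl A fun P : Profile m n => ∏ j, plProb θ (P j)) P

/-- The comparison weights converge in probability to their expectations. -/
lemma tendsto_profileProb_kappa {m : ℕ} (G : Breaking m) (θ : Fin m → ℝ)
    {q : (Fin m → Fin m → ℝ) → Prop}
    (hq : ∀ᶠ κ in 𝓝 (kbar G.weight fun i => Real.exp (θ i)), q κ) :
    Tendsto (fun n => profileProb θ n {P | ¬ q (G.kappa P)}) atTop (𝓝 0) := by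
  obtain ⟨δ, hδ, hδq⟩ := Metric.eventually_nhds_iff.1 hq
  set κ₀ := kbar G.weight fun i => Real.exp (θ i) with hκ₀
  set Y : Fin m → Fin m → Ranking m → ℝ := fun a b R => G.comparison a b R - κ₀ a b with hYdef
  have hY : ∀ a b, ∑ R, plProb θ R * Y a b R = 0 := by
    intro a b
    simp only [hYdef, mul_sub, Finset.sum_sub_distrib]
    rw [← Finset.sum_mul, sum_plProb, one_mul]
    exact sub_self _
  set V := ∑ a, ∑ b, ∑ R, plProb θ R * Y a b R ^ 2 with hV
  have hlim : Tendsto (fun n : ℕ => V / δ ^ 2 / (n : ℝ)) atTop (𝓝 0) :=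
    tendsto_const_div_atTop_nhds_zero_nat _
  refine squeeze_zero' (Eventually.of_forall fun n => profileProb_nonneg θ n _) ?_ hlim
  filter_upwards [eventually_gt_atTop 0] with n hn
  have hn' : (0 : ℝ) < n := Nat.cast_pos.2 hn
  -- Chebyshev with a union bound: if `q` fails, some entry of `κ` deviates by at least `δ`.
  have hpt : ∀ P : Profile m n,
      ({P | ¬ q (G.kappa P)} : Set (Profile m n)).indicator (fun P => ∏ j, plProb θ (P j)) P
        ≤ ∑ a, ∑ b, (∏ j, plProb θ (P j)) * (∑ j, Y a b (P j)) ^ 2 / (n * δ) ^ 2 := by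
    intro P
    have hw := prod_plProb_nonneg θ P
    have hnn : ∀ a b, 0 ≤ (∏ j, plProb θ (P j)) * (∑ j, Y a b (P j)) ^ 2 / (n * δ) ^ 2 :=
      fun a b => by positivity
    by_cases hP : q (G.kappa P)
    · rw [Set.indicator_of_notMem (by simpa using hP)]
      exact Finset.sum_nonneg fun a _ => Finset.sum_nonneg fun b _ => hnn a b
    · rw [Set.indicator_of_mem (by simpa using hP)]
      have hd : ¬ dist (G.kappa P) κ₀ < δ := fun h => hP (hδq h)
      simp only [dist_pi_lt_iff hδ, not_forall, not_lt] at hd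
      obtain ⟨a, b, hab⟩ := hd
      have hsum : G.kappa P a b - κ₀ a b = (∑ j, Y a b (P j)) / n := by
        simp only [hYdef, Finset.sum_sub_distrib, Breaking.kappa]
        simp
        field_simp
      rw [Real.dist_eq, hsum, abs_div, abs_of_pos hn', le_div_iff₀ hn'] at hab
      have h1 : (n * δ) ^ 2 ≤ (∑ j, Y a b (P j)) ^ 2 := by
        rw [← sq_abs (∑ j, Y a b (P j))]
        gcongr
        linarith
      calc ∏ j, plProb θ (P j)
          ≤ (∏ j, plProb θ (P j)) * (∑ j, Y a b (P j)) ^ 2 / (n * δ) ^ 2 := by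
            rw [le_div_iff₀ (by positivity)]
            gcongr
        _ ≤ ∑ b, (∏ j, plProb θ (P j)) * (∑ j, Y a b (P j)) ^ 2 / (n * δ) ^ 2 :=
            Finset.single_le_sum (fun b _ => hnn a b) (Finset.mem_univ b)
        _ ≤ _ := Finset.single_le_sum (fun a _ => Finset.sum_nonneg fun b _ => hnn a b)
            (Finset.mem_univ a)
  refine (Finset.sum_le_sum fun P _ => hpt P).trans (le_of_eq ?_)
  rw [Finset.sum_comm]
  have h2 : ∀ a b, ∑ P : Profile m n,
      (∏ j, plProb θ (P j)) * (∑ j, Y a b (P j)) ^ 2 / (n * δ) ^ 2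
        = (∑ R, plProb θ R * Y a b R ^ 2) / (n * δ ^ 2) := by
    intro a b
    rw [← Finset.sum_div, sum_prod_mul_sum_sq (sum_plProb θ) (hY a b)]
    field_simp
  have h3 : ∀ a, ∑ P : Profile m n, ∑ b,
      (∏ j, plProb θ (P j)) * (∑ j, Y a b (P j)) ^ 2 / (n * δ) ^ 2
        = (∑ b, ∑ R, plProb θ R * Y a b R ^ 2) / (n * δ ^ 2) := by
    intro a
    rw [Finset.sum_comm, Finset.sum_div]
    exact Finset.sum_congr rfl fun b _ => h2 a b
  simp only [h3]
  rw [← Finset.sum_div, ← hV]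
  field_simp

/-! ### The composite log-likelihood as a function of the comparison weights -/

/-- The composite log-likelihood with uniform weights `w`, for given comparison weights `κ`. -/
noncomputable def clik {m : ℕ} (w : ℝ) (κ : Fin m → Fin m → ℝ) (θ : Fin m → ℝ) : ℝ :=
  ∑ a, ∑ b, if a ≠ b then κ a b * w * Real.log (pairProb θ a b) else 0

lemma pairProb_pos {m : ℕ} (θ : Fin m → ℝ) {a b : Fin m} (hab : a ≠ b) : 0 < pairProb θ a b := by
  rw [pairProb_eq θ hab]
  positivity

lemma pairProb_add_swap {m : ℕ} (θ : Fin m → ℝ) {a b : Fin m} (hab : a ≠ b) :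
    pairProb θ a b + pairProb θ b a = 1 := by
  rw [pairProb_eq θ hab, pairProb_eq θ hab.symm, add_comm (Real.exp (θ b)), ← add_div, div_self]
  positivity

lemma log_pairProb_nonpos {m : ℕ} (θ : Fin m → ℝ) {a b : Fin m} (hab : a ≠ b) :
    Real.log (pairProb θ a b) ≤ 0 := by
  refine Real.log_nonpos (pairProb_pos θ hab).le ?_
  linarith [pairProb_add_swap θ hab, pairProb_pos θ hab.symm]

lemma log_pairProb_le {m : ℕ} (θ : Fin m → ℝ) {a b : Fin m} (hab : a ≠ b) :
    Real.log (pairProb θ a b) ≤ θ a - θ b := by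
  rw [log_pairProb θ hab]
  have h : Real.log (Real.exp (θ b)) ≤ Real.log (Real.exp (θ a) + Real.exp (θ b)) :=
    Real.log_le_log (Real.exp_pos _) (by linarith [Real.exp_pos (θ a)])
  rw [Real.log_exp] at h
  linarith

lemma continuous_clik {m : ℕ} (w : ℝ) :
    Continuous fun z : (Fin m → Fin m → ℝ) × (Fin m → ℝ) => clik w z.1 z.2 := by
  unfold clik
  refine continuous_finsetSum _ fun a _ => continuous_finsetSum _ fun b _ => ?_
  split_ifs with hab
  · simp only [log_pairProb _ hab]
    have h : Continuous fun z : (Fin m → Fin m → ℝ) × (Fin m → ℝ) =>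
        Real.log (Real.exp (z.2 a) + Real.exp (z.2 b)) :=
      Continuous.log (by fun_prop) fun z => by positivity
    fun_prop
  · exact continuous_const

lemma continuous_clik_left {m : ℕ} (w : ℝ) (θ : Fin m → ℝ) : Continuous fun κ => clik w κ θ :=
  (continuous_clik w).comp (Continuous.prodMk_left θ)

lemma continuous_clik_right {m : ℕ} (w : ℝ) (κ : Fin m → Fin m → ℝ) : Continuous (clik w κ) :=
  (continuous_clik w).comp (Continuous.prodMk_right κ)

lemma clik_le_single {m : ℕ} {w : ℝ} (hw : 0 < w) {κ : Fin m → Fin m → ℝ} {c : ℝ} (hc : 0 < c)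
    (hκ : ∀ a b, a ≠ b → c ≤ κ a b) (θ : Fin m → ℝ) {a b : Fin m} (hab : a ≠ b) :
    clik w κ θ ≤ c * w * Real.log (pairProb θ a b) := by
  have hterm : ∀ a b, (if a ≠ b then κ a b * w * Real.log (pairProb θ a b) else 0) ≤ 0 := by
    intro a b
    split_ifs with h
    · have := hc.trans_le (hκ a b h)
      exact mul_nonpos_of_nonneg_of_nonpos (by positivity) (log_pairProb_nonpos θ h)
    · rfl
  calc clik w κ θ
      ≤ ∑ b, (if a ≠ b then κ a b * w * Real.log (pairProb θ a b) else 0) := by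
        unfold clik
        rw [← Finset.add_sum_erase _ _ (Finset.mem_univ a)]
        exact add_le_of_nonpos_right
          (Finset.sum_nonpos fun a _ => Finset.sum_nonpos fun b _ => hterm a b)
    _ ≤ (if a ≠ b then κ a b * w * Real.log (pairProb θ a b) else 0) := by
        rw [← Finset.add_sum_erase _ _ (Finset.mem_univ b)]
        exact add_le_of_nonpos_right (Finset.sum_nonpos fun b _ => hterm a b)
    _ ≤ c * w * Real.log (pairProb θ a b) := by
        rw [if_pos hab]
        have h1 := hκ a b hab
        exact mul_le_mul_of_nonpos_right (by gcongr) (log_pairProb_nonpos θ hab)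

/-- Coercivity of the composite log-likelihood on the parameter space. -/
lemma norm_mul_le_neg_clik {m : ℕ} {w : ℝ} (hw : 0 < w) {κ : Fin m → Fin m → ℝ} {c : ℝ}
    (hc : 0 < c) (hκ : ∀ a b, a ≠ b → c ≤ κ a b) {θ : Fin m → ℝ} (hθ : θ ∈ paramSpace m) :
    ‖θ‖ * (c * w) ≤ -clik w κ θ := by
  have hcw : 0 < c * w := mul_pos hc hw
  have hnn : 0 ≤ -clik w κ θ := by
    refine neg_nonneg.2 (Finset.sum_nonpos fun a _ => Finset.sum_nonpos fun b _ => ?_)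
    split_ifs with h
    · have := hc.trans_le (hκ a b h)
      exact mul_nonpos_of_nonneg_of_nonpos (by positivity) (log_pairProb_nonpos θ h)
    · rfl
  rw [← le_div_iff₀ hcw, pi_norm_le_iff_of_nonneg (by positivity)]
  intro i
  rw [le_div_iff₀ hcw, Real.norm_eq_abs]
  obtain ⟨k, rfl⟩ : ∃ k, m = k + 1 := Nat.exists_eq_succ_of_ne_zero i.pos.ne'
  have hz : θ (Fin.last k) = 0 := hθ _ (by simp)
  rcases eq_or_ne i (Fin.last k) with rfl | hi
  · simpa [hz] using hnn
  -- Comparing `i` with the last alternative, whose parameter is `0`, in both orders bounds `θ i` on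
  -- both sides.
  have h1 := clik_le_single hw hc hκ θ hi
  have h2 := clik_le_single hw hc hκ θ hi.symm
  have h3 := mul_le_mul_of_nonneg_left (log_pairProb_le θ hi) hcw.le
  have h4 := mul_le_mul_of_nonneg_left (log_pairProb_le θ hi.symm) hcw.le
  rw [hz] at h3 h4
  rcases abs_cases (θ i) with ⟨h, _⟩ | ⟨h, _⟩ <;> rw [h] <;> linarith

lemma isClosed_paramSpace (m : ℕ) : IsClosed (paramSpace m) := by
  have : paramSpace m = ⋂ i : Fin m, ⋂ _ : (i : ℕ) + 1 = m, {θ | θ i = 0} := by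
    ext θ
    simp [paramSpace]
  rw [this]
  exact isClosed_iInter fun i => isClosed_iInter fun _ =>
    isClosed_eq (continuous_apply i) continuous_const

lemma zero_mem_paramSpace (m : ℕ) : (0 : Fin m → ℝ) ∈ paramSpace m := fun _ _ => rfl

lemma exists_pos_le {m : ℕ} {κ : Fin m → Fin m → ℝ} (hκ : ∀ a b, a ≠ b → 0 < κ a b) :
    ∃ c > 0, ∀ a b, a ≠ b → c < κ a b := by
  have h : ∀ᶠ c in 𝓝[>] (0 : ℝ), ∀ a b, a ≠ b → c < κ a b := by
    simp only [eventually_all]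
    intro a b hab
    exact (eventually_lt_nhds (hκ a b hab)).filter_mono nhdsWithin_le_nhds
  obtain ⟨c, hc, hc0⟩ := (h.and self_mem_nhdsWithin).exists
  exact ⟨c, hc0, hc⟩

lemma exists_isMaxOn_clik {m : ℕ} {w : ℝ} (hw : 0 < w) {κ : Fin m → Fin m → ℝ}
    (hκ : ∀ a b, a ≠ b → 0 < κ a b) :
    ∃ θ ∈ paramSpace m, IsMaxOn (clik w κ) (paramSpace m) θ := by
  obtain ⟨c, hc, hcκ⟩ := exists_pos_le hκ
  have hcw : 0 < c * w := mul_pos hc hw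
  have hco := fun θ (hθ : θ ∈ paramSpace m) =>
    norm_mul_le_neg_clik hw hc (fun a b h => (hcκ a b h).le) hθ
  set r := -clik w κ 0 / (c * w) with hr
  have h0 : (0 : Fin m → ℝ) ∈ paramSpace m ∩ Metric.closedBall 0 r := by
    refine ⟨zero_mem_paramSpace m, Metric.mem_closedBall_self ?_⟩
    have := hco 0 (zero_mem_paramSpace m)
    rw [norm_zero, zero_mul] at this
    positivity
  obtain ⟨θ₁, hθ₁, hmax⟩ := ((isCompact_closedBall (0 : Fin m → ℝ) r).inter_left
    (isClosed_paramSpace m)).exists_isMaxOn ⟨0, h0⟩ (continuous_clik_right w κ).continuousOn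
  refine ⟨θ₁, hθ₁.1, fun θ hθ => ?_⟩
  by_cases h : ‖θ‖ ≤ r
  · exact hmax ⟨hθ, by simpa using h⟩
  · have h1 := hco θ hθ
    have h2 : clik w κ 0 ≤ clik w κ θ₁ := hmax h0
    rw [not_le, hr, div_lt_iff₀ hcw] at h
    change clik w κ θ ≤ clik w κ θ₁
    linarith

/-- Stability of the maximizers under perturbations of the comparison weights. -/
lemma eventually_maximizers_near {m : ℕ} {w : ℝ} (hw : 0 < w) {κ₀ : Fin m → Fin m → ℝ}
    (hκ₀ : ∀ a b, a ≠ b → 0 < κ₀ a b) {θ₀ : Fin m → ℝ}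
    (hmax : ∀ θ ∈ paramSpace m, θ ≠ θ₀ → clik w κ₀ θ < clik w κ₀ θ₀) {ε : ℝ} (hε : 0 < ε)
    (hθ₀ : θ₀ ∈ paramSpace m) :
    ∀ᶠ κ in 𝓝 κ₀, ∀ θ ∈ paramSpace m, IsMaxOn (clik w κ) (paramSpace m) θ → dist θ θ₀ < ε := by
  obtain ⟨c, hc, hcκ⟩ := exists_pos_le hκ₀
  have hcw : 0 < c * w := mul_pos hc hw
  have h1 : ∀ᶠ κ in 𝓝 κ₀, ∀ a b, a ≠ b → c < κ a b := by
    simp only [eventually_all]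
    intro a b hab
    have hcont : Continuous fun κ : Fin m → Fin m → ℝ => κ a b := by fun_prop
    exact hcont.continuousAt.eventually (lt_mem_nhds (hcκ a b hab))
  have h2 : ∀ᶠ κ in 𝓝 κ₀, clik w κ₀ θ₀ - 1 < clik w κ θ₀ :=
    (continuous_clik_left w θ₀).continuousAt.eventually (lt_mem_nhds (by linarith))
  -- By `h2` and coercivity, maximizers for nearby `κ` lie in this ball; on its compact part far
  -- from `θ₀`, strict inequality persists for all `κ` near `κ₀`.
  set r := (1 - clik w κ₀ θ₀) / (c * w) with hr
  have hK : IsCompact ((paramSpace m ∩ {θ | ε ≤ dist θ θ₀}) ∩ Metric.closedBall 0 r) :=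
    (isCompact_closedBall (0 : Fin m → ℝ) r).inter_left ((isClosed_paramSpace m).inter
      (isClosed_le continuous_const (continuous_id.dist continuous_const)))
  have h3 : ∀ᶠ κ in 𝓝 κ₀,
      ∀ θ ∈ (paramSpace m ∩ {θ | ε ≤ dist θ θ₀}) ∩ Metric.closedBall 0 r,
        clik w κ θ < clik w κ θ₀ := by
    refine hK.eventually_forall_of_forall_eventually fun θ hθ => ?_
    have hne : θ ≠ θ₀ := by
      rintro rfl
      have : ε ≤ dist θ θ := hθ.1.2
      rw [dist_self] at this
      linarith
    exact (isOpen_lt (continuous_clik w)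
      ((continuous_clik_left w θ₀).comp continuous_fst)).mem_nhds (hmax θ hθ.1.1 hne)
  filter_upwards [h1, h2, h3] with κ hκ1 hκ2 hκ3 θ hθ hθmax
  by_contra! hd
  have h4 : clik w κ θ₀ ≤ clik w κ θ := hθmax hθ₀
  have h5 := norm_mul_le_neg_clik hw hc (fun a b h => (hκ1 a b h).le) hθ
  refine absurd (hκ3 θ ⟨⟨hθ, hd⟩, ?_⟩) (not_lt.2 h4)
  rw [mem_closedBall_zero_iff, hr, le_div_iff₀ hcw]
  linarith

/-- Gibbs' inequality: if the comparison weights are in the ratio of the pairwise probabilities at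
`θ₀`, then `θ₀` is the unique maximizer. -/
lemma clik_lt_of_balanced {m : ℕ} {w : ℝ} (hw : 0 < w) {κ : Fin m → Fin m → ℝ}
    (hκ : ∀ a b, a ≠ b → 0 < κ a b) {θ₀ : Fin m → ℝ} (hθ₀ : θ₀ ∈ paramSpace m)
    (hbal : ∀ a b, κ a b * Real.exp (θ₀ b) = κ b a * Real.exp (θ₀ a)) {θ : Fin m → ℝ}
    (hθ : θ ∈ paramSpace m) (hne : θ ≠ θ₀) : clik w κ θ < clik w κ θ₀ := by
  -- By balance, `D` is the bound that `log t ≤ t - 1` gives at `t = p / p₀`. It is antisymmetric,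
  -- so it cancels in the sum.
  set D : Fin m → Fin m → ℝ := fun a b =>
    if a ≠ b then (κ a b + κ b a) * w * (pairProb θ a b - pairProb θ₀ a b) else 0 with hD
  have hDanti : ∀ a b, D a b = -D b a := by
    intro a b
    rcases eq_or_ne a b with rfl | hab
    · simp [hD]
    · simp only [hD, ne_eq, hab, hab.symm, not_false_eq_true, if_true]
      linear_combination (κ a b + κ b a) * w *
        (pairProb_add_swap θ hab - pairProb_add_swap θ₀ hab)
  have hDsum : ∑ a, ∑ b, D a b = 0 := by
    have h : ∑ a, ∑ b, D a b = -∑ a, ∑ b, D a b := by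
      conv_lhs => rw [Finset.sum_comm]
      simp only [← Finset.sum_neg_distrib]
      exact Finset.sum_congr rfl fun b _ => Finset.sum_congr rfl fun a _ => hDanti a b
    linarith
  have hs : ∀ a b, a ≠ b → (κ a b + κ b a) * pairProb θ₀ a b = κ a b := by
    intro a b hab
    rw [pairProb_eq θ₀ hab]
    have := hbal a b
    field_simp
    linarith
  have hkey : ∀ a b, a ≠ b → κ a b * w * Real.log (pairProb θ a b)
      - κ a b * w * Real.log (pairProb θ₀ a b) = κ a b * w *
        Real.log (pairProb θ a b / pairProb θ₀ a b) := by
    intro a b hab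
    rw [Real.log_div (pairProb_pos θ hab).ne' (pairProb_pos θ₀ hab).ne']
    ring
  have hDeq : ∀ a b, a ≠ b → (κ a b + κ b a) * w * (pairProb θ a b - pairProb θ₀ a b)
      = κ a b * w * (pairProb θ a b / pairProb θ₀ a b - 1) := by
    intro a b hab
    have h0 := (pairProb_pos θ₀ hab).ne'
    have h1 := hs a b hab
    rw [div_sub_one h0, mul_div_assoc', eq_div_iff h0]
    linear_combination w * (pairProb θ a b - pairProb θ₀ a b) * h1
  have hle : ∀ a b, (if a ≠ b then κ a b * w * Real.log (pairProb θ a b) else 0)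
      ≤ (if a ≠ b then κ a b * w * Real.log (pairProb θ₀ a b) else 0) + D a b := by
    intro a b
    rcases eq_or_ne a b with rfl | hab
    · simp [hD]
    · simp only [hD, ne_eq, hab, not_false_eq_true, if_true]
      rw [hDeq a b hab, ← sub_le_iff_le_add', hkey a b hab]
      have := hκ a b hab
      gcongr
      exact Real.log_le_sub_one_of_pos (div_pos (pairProb_pos θ hab) (pairProb_pos θ₀ hab))
  obtain ⟨i, hi⟩ := Function.ne_iff.1 hne
  obtain ⟨k, rfl⟩ : ∃ k, m = k + 1 := Nat.exists_eq_succ_of_ne_zero i.pos.ne'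
  have hz : θ (Fin.last k) = 0 := hθ _ (by simp)
  have hz₀ : θ₀ (Fin.last k) = 0 := hθ₀ _ (by simp)
  have hil : i ≠ Fin.last k := by
    rintro rfl
    exact hi (hz.trans hz₀.symm)
  have hp : pairProb θ i (Fin.last k) ≠ pairProb θ₀ i (Fin.last k) := by
    rw [pairProb_eq θ hil, pairProb_eq θ₀ hil, hz, hz₀]
    intro h
    rw [div_eq_div_iff (by positivity) (by positivity)] at h
    refine hi (Real.exp_injective ?_)
    simp only [Real.exp_zero] at h
    linarith
  have hlt : (if i ≠ Fin.last k then κ i (Fin.last k) * w *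
        Real.log (pairProb θ i (Fin.last k)) else 0)
      < (if i ≠ Fin.last k then κ i (Fin.last k) * w *
        Real.log (pairProb θ₀ i (Fin.last k)) else 0) + D i (Fin.last k) := by
    simp only [hD, ne_eq, hil, not_false_eq_true, if_true]
    rw [hDeq _ _ hil, ← sub_lt_iff_lt_add', hkey _ _ hil]
    have := hκ _ _ hil
    refine mul_lt_mul_of_pos_left ?_ (by positivity)
    refine Real.log_lt_sub_one_of_pos (div_pos (pairProb_pos θ hil) (pairProb_pos θ₀ hil)) ?_
    rw [Ne, div_eq_one_iff_eq (pairProb_pos θ₀ hil).ne']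
    exact hp
  calc clik w κ θ
      < ∑ a, ∑ b, ((if a ≠ b then κ a b * w * Real.log (pairProb θ₀ a b) else 0) + D a b) := by
        refine Finset.sum_lt_sum (fun a _ => Finset.sum_le_sum fun b _ => hle a b)
          ⟨i, Finset.mem_univ i, ?_⟩
        exact Finset.sum_lt_sum (fun b _ => hle i b) ⟨Fin.last k, Finset.mem_univ _, hlt⟩
    _ = clik w κ θ₀ := by
        simp only [Finset.sum_add_distrib, hDsum, add_zero]
        rfl

lemma clik_add_const {m : ℕ} (w : ℝ) (κ : Fin m → Fin m → ℝ) (θ : Fin m → ℝ) (s : ℝ) :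
    clik w κ (fun i => s + θ i) = clik w κ θ := by
  unfold clik pairProb
  simp only [plProb_eq_plw, Real.exp_add, plw_smul _ (Real.exp_pos s).ne']

lemma exists_shift_mem_paramSpace {m : ℕ} (θ : Fin m → ℝ) :
    ∃ s : ℝ, (fun i => s + θ i) ∈ paramSpace m := by
  cases m with
  | zero => exact ⟨0, fun i => i.elim0⟩
  | succ k =>
    refine ⟨-θ (Fin.last k), fun i hi => ?_⟩
    have : i = Fin.last k := Fin.ext (by simpa using hi)
    simp [this]

/-- First order condition at a maximizer of the expected composite log-likelihood. -/
lemma score_eq_zero_of_isMaxOn {m : ℕ} {w : ℝ} (hw : 0 < w) (g : Fin m → Fin m → ℝ)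
    {θ₀ : Fin m → ℝ}
    (hmax : IsMaxOn (clik w (kbar g fun i => Real.exp (θ₀ i))) (paramSpace m) θ₀) (a : Fin m) :
    score g (fun i => Real.exp (θ₀ i)) a = 0 := by
  set x : Fin m → ℝ := fun i => Real.exp (θ₀ i) with hx
  set κ := kbar g x with hκ
  have hxpos : ∀ i, 0 < x i := fun i => Real.exp_pos _
  -- Shift invariance makes the maximum global, so the derivative in direction `a` vanishes even
  -- when `a` is the normalized alternative.
  have hglob : ∀ θ, clik w κ θ ≤ clik w κ θ₀ := by
    intro θ
    obtain ⟨s, hs⟩ := exists_shift_mem_paramSpace θ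
    rw [← clik_add_const w κ θ s]
    exact hmax hs
  set e : Fin m → ℝ := Pi.single a 1 with he
  have hderiv : HasDerivAt (fun t : ℝ => clik w κ (fun i => θ₀ i + t * e i))
      (∑ c, ∑ d, if c ≠ d then κ c d * w * (e c - (x c * e c + x d * e d) / (x c + x d)) else 0)
      0 := by
    unfold clik
    refine HasDerivAt.fun_sum fun c _ => HasDerivAt.fun_sum fun d _ => ?_
    split_ifs with hcd
    · simp only [log_pairProb _ hcd]
      refine HasDerivAt.const_mul _ ?_
      have hl : ∀ i, HasDerivAt (fun t : ℝ => θ₀ i + t * e i) (e i) 0 := by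
        intro i
        simpa using ((hasDerivAt_id (0 : ℝ)).mul_const (e i)).const_add (θ₀ i)
      have hex : ∀ i, HasDerivAt (fun t : ℝ => Real.exp (θ₀ i + t * e i)) (x i * e i) 0 := by
        intro i
        simpa [hx] using (hl i).exp
      have hlog := ((hex c).fun_add (hex d)).log (by simp; positivity)
      simpa [hx] using (hl c).fun_sub hlog
    · exact hasDerivAt_const _ _
  have hloc : IsLocalMax (fun t : ℝ => clik w κ (fun i => θ₀ i + t * e i)) 0 := by
    refine Eventually.of_forall fun t => ?_
    simpa using hglob _
  have h0 := hloc.hasDerivAt_eq_zero hderiv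
  have hterm : ∀ c d, (if c ≠ d then
      κ c d * w * (e c - (x c * e c + x d * e d) / (x c + x d)) else 0)
        = w * (κ c d * x d / (x c + x d) * e c) - w * (κ c d * x d / (x c + x d) * e d) := by
    intro c d
    rcases eq_or_ne c d with rfl | hcd
    · simp
    · rw [if_pos hcd]
      have := (add_pos (hxpos c) (hxpos d)).ne'
      field_simp
      ring
  simp only [hterm, Finset.sum_sub_distrib, ← Finset.mul_sum] at h0
  rw [← mul_sub, mul_eq_zero, or_iff_right hw.ne'] at h0
  simp only [he, Pi.single_apply, mul_ite, mul_one, mul_zero, Finset.sum_ite_eq',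
    Finset.mem_univ, if_true] at h0
  rw [Finset.sum_comm] at h0
  simp only [Finset.sum_ite_eq', Finset.mem_univ, if_true] at h0
  rw [← h0, score, ← Finset.sum_sub_distrib]
  refine Finset.sum_congr rfl fun b _ => ?_
  rw [add_comm (x b) (x a), sub_div]

/-! ### Consistency -/

lemma positionBreaking_weight_of_lt {m : ℕ} {i j : Fin m} (hij : i < j) (k : Fin m) :
    (positionBreaking k).weight i j = if k = i then 1 else 0 := by
  unfold positionBreaking
  refine if_congr ⟨?_, ?_⟩ rfl rfl
  · rintro (⟨rfl, _⟩ | ⟨rfl, h⟩)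
    exacts [rfl, absurd h hij.not_gt]
  · rintro rfl
    exact Or.inl ⟨rfl, hij⟩

/-- Nonnegativity of `c` is automatic except at the last position, which has no edge below it;
truncating at `0` repairs that value. -/
lemma Breaking.isWeightedUnion_iff {m : ℕ} (G : Breaking m) :
    G.IsWeightedUnion ↔ ∃ c : Fin m → ℝ, ∀ i j, i < j → G.weight i j = c i := by
  constructor
  · rintro ⟨c, -, hc⟩
    refine ⟨c, fun i j hij => ?_⟩
    simp [hc, positionBreaking_weight_of_lt hij]
  · rintro ⟨c, hc⟩
    have hlt : ∀ i j, i < j →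
        G.weight i j = ∑ k, max (c k) 0 * (positionBreaking k).weight i j := by
      intro i j hij
      have h := G.nonneg i j
      rw [hc i j hij] at h
      simp [hc i j hij, positionBreaking_weight_of_lt hij, h]
    refine ⟨fun k => max (c k) 0, fun k => le_max_right _ _, fun i j => ?_⟩
    rcases lt_trichotomy i j with h | rfl | h
    · exact hlt i j h
    · simp [G.loopless, (positionBreaking _).loopless]
    · rw [G.symm, hlt j i h]
      exact Finset.sum_congr rfl fun k _ => by rw [(positionBreaking k).symm]

lemma Breaking.exists_lt_weight_pos {m : ℕ} {G : Breaking m} (hG : ∃ i j, 0 < G.weight i j) :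
    ∃ i j, i < j ∧ 0 < G.weight i j := by
  obtain ⟨i, j, h⟩ := hG
  rcases lt_trichotomy i j with hij | rfl | hij
  · exact ⟨i, j, hij, h⟩
  · exact absurd h (by simp [G.loopless])
  · exact ⟨j, i, hij, by rwa [G.symm]⟩

/-- Consistency quantifies over all such estimators and would be vacuous without one. -/
lemma exists_isRBCML {m : ℕ} (G : Breaking m) (W : Fin m → Fin m → ℝ) :
    ∃ T : Estimator m, T.IsRBCML G W := by
  have h : ∀ (n : ℕ) (P : Profile m n), ∃ θ, θ ∈ paramSpace m ∧
      ((rbcml G W P).Nonempty → θ ∈ rbcml G W P) := by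
    intro n P
    by_cases hne : (rbcml G W P).Nonempty
    · obtain ⟨θ, hθ⟩ := hne
      exact ⟨θ, hθ.1, fun _ => hθ⟩
    · exact ⟨0, zero_mem_paramSpace m, fun h => absurd h hne⟩
  choose T hT using h
  exact ⟨T, hT⟩

lemma eventually_forall_pos {m : ℕ} {κ₀ : Fin m → Fin m → ℝ} (h : ∀ a b, a ≠ b → 0 < κ₀ a b) :
    ∀ᶠ κ in 𝓝 κ₀, ∀ a b, a ≠ b → 0 < κ a b := by
  simp only [eventually_all]
  intro a b hab
  have hcont : Continuous fun κ : Fin m → Fin m → ℝ => κ a b := by fun_prop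
  exact hcont.continuousAt.eventually (lt_mem_nhds (h a b hab))

/-- Positive comparison weights guarantee a maximizer, so the arbitrary default output plays no
role. -/
lemma mem_rbcml_of_pos {m n : ℕ} {G : Breaking m} {w : ℝ} (hw : 0 < w) {T : Estimator m}
    (hT : T.IsRBCML G (uniformWeights m w)) {P : Profile m n}
    (hP : ∀ a b, a ≠ b → 0 < G.kappa P a b) : T n P ∈ rbcml G (uniformWeights m w) P := by
  obtain ⟨θ, hθ, hmax⟩ := exists_isMaxOn_clik hw hP
  exact (hT n P).2 ⟨θ, hθ, hmax⟩

/-- If RBCML is consistent, the ground truth maximizes the expected composite log-likelihood. -/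
lemma isMaxOn_of_isConsistentRBCML {m : ℕ} {G : Breaking m} (hG : ∃ i j, 0 < G.weight i j) {w : ℝ}
    (hw : 0 < w) (h : IsConsistentRBCML G (uniformWeights m w)) {θ₀ : Fin m → ℝ}
    (hθ₀ : θ₀ ∈ paramSpace m) :
    IsMaxOn (clik w (kbar G.weight fun i => Real.exp (θ₀ i))) (paramSpace m) θ₀ := by
  obtain ⟨T, hT⟩ := exists_isRBCML G (uniformWeights m w)
  set κ₀ := kbar G.weight fun i => Real.exp (θ₀ i) with hκ₀
  intro θ₁ hθ₁
  by_contra hlt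
  replace hlt : clik w κ₀ θ₀ < clik w κ₀ θ₁ := not_le.1 hlt
  have hpos : ∀ a b, a ≠ b → 0 < κ₀ a b := by
    obtain ⟨i, j, hij, hw⟩ := Breaking.exists_lt_weight_pos hG
    exact fun a b hab => kbar_pos G.nonneg hij hw (fun i => Real.exp_pos _) hab
  have hnhds : ∀ᶠ z in 𝓝 (κ₀, θ₀), clik w z.1 z.2 < clik w z.1 θ₁ :=
    (isOpen_lt (continuous_clik w)
      ((continuous_clik_left w θ₁).comp continuous_fst)).mem_nhds hlt
  rw [nhds_prod_eq, eventually_prod_iff] at hnhds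
  obtain ⟨pa, hpa, pb, hpb, hab⟩ := hnhds
  obtain ⟨ε, hε, hεb⟩ := Metric.eventually_nhds_iff.1 hpb
  have hfar := h T hT θ₀ hθ₀ ε hε
  have hbad := tendsto_profileProb_kappa G θ₀ ((eventually_forall_pos hpos).and hpa)
  -- If the estimate is near `θ₀` and `κ` near `κ₀`, then `θ₁` beats the supposed maximizer. So the
  -- two events cover all profiles, although both probabilities tend to `0`.
  have hone : ∀ n, 1 ≤ profileProb θ₀ n {P | ε ≤ dist (T n P) θ₀} +
      profileProb θ₀ n {P | ¬ ((∀ a b, a ≠ b → 0 < G.kappa P a b) ∧ pa (G.kappa P))} := by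
    intro n
    rw [← profileProb_add_compl θ₀ n {P | ε ≤ dist (T n P) θ₀}]
    refine add_le_add_right (profileProb_mono θ₀ n ?_) _
    intro P hP hq
    have hmem := mem_rbcml_of_pos hw hT hq.1
    have hnear : dist (T n P) θ₀ < ε := not_le.1 hP
    have h1 : clik w (G.kappa P) (T n P) < clik w (G.kappa P) θ₁ := hab hq.2 (hεb hnear)
    exact absurd (hmem.2 hθ₁) (not_le.2 h1)
  have := ge_of_tendsto' (hfar.add hbad) hone
  norm_num at this

lemma isWeightedUnion_of_isConsistentRBCML {m : ℕ} {G : Breaking m}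
    (hG : ∃ i j, 0 < G.weight i j) {w : ℝ} (hw : 0 < w)
    (h : IsConsistentRBCML G (uniformWeights m w)) : G.IsWeightedUnion := by
  rw [Breaking.isWeightedUnion_iff]
  refine weight_eq_of_score_eq_zero G.weight fun x hx a => ?_
  -- Up to scaling, every positive `x` comes from a normalized parameter.
  obtain ⟨s, hs⟩ := exists_shift_mem_paramSpace fun i => Real.log (x i)
  have h1 := score_eq_zero_of_isMaxOn hw G.weight (isMaxOn_of_isConsistentRBCML hG hw h hs) a
  simp only [Real.exp_add, Real.exp_log (hx _)] at h1
  rwa [score_smul _ _ (Real.exp_pos s).ne'] at h1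

lemma isConsistentRBCML_of_isWeightedUnion {m : ℕ} {G : Breaking m}
    (hG : ∃ i j, 0 < G.weight i j) {w : ℝ} (hw : 0 < w) (h : G.IsWeightedUnion) :
    IsConsistentRBCML G (uniformWeights m w) := by
  obtain ⟨c, hc⟩ := G.isWeightedUnion_iff.1 h
  intro T hT θ₀ hθ₀ ε hε
  set κ₀ := kbar G.weight fun i => Real.exp (θ₀ i) with hκ₀
  have hpos : ∀ a b, a ≠ b → 0 < κ₀ a b := by
    obtain ⟨i, j, hij, hw⟩ := Breaking.exists_lt_weight_pos hG
    exact fun a b hab => kbar_pos G.nonneg hij hw (fun i => Real.exp_pos _) hab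
  have hbal : ∀ a b, κ₀ a b * Real.exp (θ₀ b) = κ₀ b a * Real.exp (θ₀ a) := by
    intro a b
    rw [hκ₀, kbar_congr hc, kbar_congr hc]
    exact kbar_balance c (fun i => Real.exp_pos (θ₀ i)) a b
  have hev := (eventually_forall_pos hpos).and (eventually_maximizers_near hw hpos
    (fun θ hθ hne => clik_lt_of_balanced hw hpos hθ₀ hbal hθ hne) hε hθ₀)
  refine squeeze_zero (fun n => profileProb_nonneg θ₀ n _)
    (fun n => profileProb_mono θ₀ n ?_) (tendsto_profileProb_kappa G θ₀ hev)
  intro P hP hq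
  have hmem := mem_rbcml_of_pos hw hT hq.1
  exact absurd (hq.2 _ hmem.1 hmem.2) (not_lt.2 hP)

end RBCML

theorem mainTheorem7 (m : ℕ) (G : RBCML.Breaking m) (hG : ∃ i j, 0 < G.weight i j)
    (w : ℝ) (hw : 0 < w) :
    RBCML.IsConsistentRBCML G (RBCML.uniformWeights m w) ↔ G.IsWeightedUnion :=
  ⟨RBCML.isWeightedUnion_of_isConsistentRBCML hG hw,
    RBCML.isConsistentRBCML_of_isWeightedUnion hG hw⟩
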